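/- Let $\mathbb{K}\in\{\mathbb{R},\mathbb{C}\}$, let $\Psi,\widetilde\Psi\in\mathbb{K}^{m\times n}$, let $x^\star\in\mathbb{K}^n$ be $s$-sparse (at most $s$ nonzero entries), let $z\in\mathbb{K}^m$ and $y=\Psi x^\star+z$. Notation. For $M\in\mathbb{K}^{n\times n}$, $\theta_r(M)$ is the smallest $\delta\ge 0$ such that $|\langle v,Mu\rangle-\langle v,u\rangle|\le\delta\|u\|_2\|v\|_2$ for all $u,v$ supported on a common set of at most $r$ indices. For $A\in\mathbb{K}^{m\times n}$, $\delta_r(A)$ is the smallest $\delta\ge0$ such that $(1-\delta)\|u\|_2^2\le\|Au\|_2^2\le(1+\delta)\|u\|_2^2$ for all $r$-sparse $u$. $H_r(v)$ is a minimizer of $\|v-w\|_2$ over all $r$-sparse $w$ (ties broken arbitrarily), $A_J$ is the submatrix of the columns of $A$ indexed by $J$, and $\mathrm{LS}(J)$ is a minimizer of $\|\widetilde\Psi_J^*(y-\Psi x)\|_2$ over all $x\in\mathbb{K}^n$ with $\operatorname{supp}x\subset J$. Starting from an arbitrary $s$-sparse $x_0$ (for example $x_0=0$), the algorithms iterate as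 follows. - ObSP: $\widetilde J_{t+1}=\operatorname{supp}x_t\cup\operatorname{supp}H_s(\widetilde\Psi^*(y-\Psi x_t))$, $\widetilde x=\mathrm{LS}(\widetilde J_{t+1})$, $J_{t+1}=\operatorname{supp}H_s(\widetilde x)$, $x_{t+1}=\mathrm{LS}(J_{t+1})$. - ObCoSaMP: $\widetilde J_{t+1}=\operatorname{supp}x_t\cup\operatorname{supp}H_{2s}(\widetilde\Psi^*(y-\Psi x_t))$, $\widetilde x=\mathrm{LS}(\widetilde J_{t+1})$, $x_{t+1}=H_s(\widetilde x)$. - ObHTP: $J_{t+1}=\operatorname{supp}H_s(x_t+\widetilde\Psi^*(y-\Psi x_t))$, $x_{t+1}=\mathrm{LS}(J_{t+1})$. Theorem. Let $\mathtt{Alg}\in\{\text{ObSP},\text{ObCoSaMP},\text{ObHTP}\}$, and let $(k,c)=(3,0.325)$ for ObSP, $(k,c)=(4,0.384)$ for ObCoSaMP, $(k,c)=(3,0.577)$ for ObHTP. There are a positive integer $C_1$ depending only on $\mathtt{Alg}$, and a positive number $C_2$ depending only on $\mathtt{Alg}$, $\delta_{ks}(\Psi)$ and $\delta_{ks}(\widetilde\Psi)$,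 such that the following holds for all $m,n,s,\Psi,\widetilde\Psi,x^\star,z$ as above: if $\theta_{ks}(\widetilde\Psi^*\Psi)<c$, then, after $t_{\max}=C_1(s+1)$ iterations, $\mathtt{Alg}$ provides an estimate $\widehat x=x_{t_{\max}}$ with $\|\widehat x-x^\star\|_2\le C_2\|z\|_2$; the same bound holds for every later iterate $x_t$, $t\ge t_{\max}$. -/

import Mathlib

noncomputable section

open Classical in
/-- The support `supp x ⊆ [n]` of a vector. -/
def vecSupp {𝕜 : Type*} [RCLike 𝕜] {n : ℕ} (x : EuclideanSpace 𝕜 (Fin n)) : Finset (Fin n) :=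
  Finset.univ.filter fun i => x i ≠ 0

/-- `x` is `s`-sparse: `‖x‖₀ ≤ s`. -/
def IsSparse {𝕜 : Type*} [RCLike 𝕜] {n : ℕ} (s : ℕ) (x : EuclideanSpace 𝕜 (Fin n)) : Prop :=
  (vecSupp x).card ≤ s

/-- The `s`-restricted isometry constant `δ_s(Ψ)`: the smallest (nonnegative) `δ` with
`(1 - δ) ‖x‖² ≤ ‖Ψ x‖² ≤ (1 + δ) ‖x‖²` for all `s`-sparse `x`. -/
def ric {𝕜 : Type*} [RCLike 𝕜] {m n : ℕ} (s : ℕ) (Ψ : Matrix (Fin m) (Fin n) 𝕜) : ℝ :=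
  sInf {δ : ℝ | 0 ≤ δ ∧ ∀ x : EuclideanSpace 𝕜 (Fin n), IsSparse s x →
    (1 - δ) * ‖x‖ ^ 2 ≤ ‖Matrix.toEuclideanLin Ψ x‖ ^ 2 ∧ ‖Matrix.toEuclideanLin Ψ x‖ ^ 2 ≤ (1 + δ) * ‖x‖ ^ 2}

/-- The `s`-restricted biorthogonality constant `θ_s(M)`: the smallest (nonnegative) `δ` with
`|⟨y, M x⟩ - ⟨y, x⟩| ≤ δ ‖x‖ ‖y‖` for all `x`, `y` supported on a common set of at most `s`
indices. -/
def rboc {𝕜 : Type*} [RCLike 𝕜] {n : ℕ} (s : ℕ) (M : Matrix (Fin n) (Fin n) 𝕜) : ℝ :=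
  sInf {δ : ℝ | 0 ≤ δ ∧ ∀ J : Finset (Fin n), J.card ≤ s →
    ∀ x y : EuclideanSpace 𝕜 (Fin n), vecSupp x ⊆ J → vecSupp y ⊆ J →
      ‖inner 𝕜 y (Matrix.toEuclideanLin M x) - inner 𝕜 y x‖ ≤ δ * ‖x‖ * ‖y‖}

/-- `w` is a value of the hard thresholding operator `H_k(v)`: a minimizer of `‖v - w‖` over all
`k`-sparse `w`. (When there are ties, every minimizer is allowed.) -/
def IsHardThreshold {𝕜 : Type*} [RCLike 𝕜] {n : ℕ} (k : ℕ)
    (v w : EuclideanSpace 𝕜 (Fin n)) : Prop :=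
  IsSparse k w ∧ ∀ w' : EuclideanSpace 𝕜 (Fin n), IsSparse k w' → ‖v - w‖ ≤ ‖v - w'‖

/-- The submatrix `A_J` of the columns indexed by `J`. -/
def colSub {𝕜 : Type*} [RCLike 𝕜] {m n : ℕ} (A : Matrix (Fin m) (Fin n) 𝕜)
    (J : Finset (Fin n)) : Matrix (Fin m) J 𝕜 :=
  A.submatrix id (fun j => (j : Fin n))

/-- `x ∈ argmin_x { ‖Ψ̃_J^* (y - Ψ x)‖₂ : supp x ⊆ J }`. -/
def IsObliqueLS {𝕜 : Type*} [RCLike 𝕜] {m n : ℕ} (Ψ Ψt : Matrix (Fin m) (Fin n) 𝕜)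
    (y : EuclideanSpace 𝕜 (Fin m)) (J : Finset (Fin n)) (x : EuclideanSpace 𝕜 (Fin n)) : Prop :=
  vecSupp x ⊆ J ∧ ∀ w : EuclideanSpace 𝕜 (Fin n), vecSupp w ⊆ J →
    ‖Matrix.toEuclideanLin (colSub Ψt J).conjTranspose (y - Matrix.toEuclideanLin Ψ x)‖ ≤
      ‖Matrix.toEuclideanLin (colSub Ψt J).conjTranspose (y - Matrix.toEuclideanLin Ψ w)‖

/-- The proxy `Ψ̃^* (y - Ψ x)`. -/
def proxy {𝕜 : Type*} [RCLike 𝕜] {m n : ℕ} (Ψ Ψt : Matrix (Fin m) (Fin n) 𝕜)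
    (y : EuclideanSpace 𝕜 (Fin m)) (x : EuclideanSpace 𝕜 (Fin n)) : EuclideanSpace 𝕜 (Fin n) :=
  Matrix.toEuclideanLin Ψt.conjTranspose (y - Matrix.toEuclideanLin Ψ x)

/-- One iteration `x ↦ x'` of oblique subspace pursuit. -/
def ObSPStep {𝕜 : Type*} [RCLike 𝕜] {m n : ℕ} (s : ℕ) (Ψ Ψt : Matrix (Fin m) (Fin n) 𝕜)
    (y : EuclideanSpace 𝕜 (Fin m)) (x x' : EuclideanSpace 𝕜 (Fin n)) : Prop :=
  ∃ h xt hs : EuclideanSpace 𝕜 (Fin n),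
    IsHardThreshold s (proxy Ψ Ψt y x) h ∧
    IsObliqueLS Ψ Ψt y (vecSupp x ∪ vecSupp h) xt ∧
    IsHardThreshold s xt hs ∧
    IsObliqueLS Ψ Ψt y (vecSupp hs) x'

/-- One iteration `x ↦ x'` of oblique CoSaMP. -/
def ObCoSaMPStep {𝕜 : Type*} [RCLike 𝕜] {m n : ℕ} (s : ℕ) (Ψ Ψt : Matrix (Fin m) (Fin n) 𝕜)
    (y : EuclideanSpace 𝕜 (Fin m)) (x x' : EuclideanSpace 𝕜 (Fin n)) : Prop :=
  ∃ h xt : EuclideanSpace 𝕜 (Fin n),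
    IsHardThreshold (2 * s) (proxy Ψ Ψt y x) h ∧
    IsObliqueLS Ψ Ψt y (vecSupp x ∪ vecSupp h) xt ∧
    IsHardThreshold s xt x'

/-- One iteration `x ↦ x'` of oblique hard thresholding pursuit. -/
def ObHTPStep {𝕜 : Type*} [RCLike 𝕜] {m n : ℕ} (s : ℕ) (Ψ Ψt : Matrix (Fin m) (Fin n) 𝕜)
    (y : EuclideanSpace 𝕜 (Fin m)) (x x' : EuclideanSpace 𝕜 (Fin n)) : Prop :=
  ∃ h : EuclideanSpace 𝕜 (Fin n),
    IsHardThreshold s (x + proxy Ψ Ψt y x) h ∧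
    IsObliqueLS Ψ Ψt y (vecSupp h) x'

/-- The three iterative oblique pursuits that involve a least squares step. -/
inductive ObliqueAlg where
  | obSP : ObliqueAlg
  | obCoSaMP : ObliqueAlg
  | obHTP : ObliqueAlg

/-- One iteration of the algorithm `alg`. -/
def ObliqueAlg.Step {𝕜 : Type*} [RCLike 𝕜] {m n : ℕ} (alg : ObliqueAlg) (s : ℕ)
    (Ψ Ψt : Matrix (Fin m) (Fin n) 𝕜) (y : EuclideanSpace 𝕜 (Fin m))
    (x x' : EuclideanSpace 𝕜 (Fin n)) : Prop :=
  match alg with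
  | .obSP => ObSPStep s Ψ Ψt y x x'
  | .obCoSaMP => ObCoSaMPStep s Ψ Ψt y x x'
  | .obHTP => ObHTPStep s Ψ Ψt y x x'

/-- `(x_t)` is a sequence of iterates of `alg` with data `(s, Ψ, Ψ̃, y)`, started at an `s`-sparse
vector (for instance at `0`). -/
def ObliqueAlg.Generates {𝕜 : Type*} [RCLike 𝕜] {m n : ℕ} (alg : ObliqueAlg) (s : ℕ)
    (Ψ Ψt : Matrix (Fin m) (Fin n) 𝕜) (y : EuclideanSpace 𝕜 (Fin m))
    (x : ℕ → EuclideanSpace 𝕜 (Fin n)) : Prop :=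
  IsSparse s (x 0) ∧ ∀ t : ℕ, alg.Step s Ψ Ψt y (x t) (x (t + 1))

/-- The factor `k` in the order `ks` of the condition `θ_{ks}(Ψ̃^* Ψ) < c`. -/
def ObliqueAlg.order : ObliqueAlg → ℕ
  | .obSP => 3
  | .obCoSaMP => 4
  | .obHTP => 3

/-- The threshold `c` in the condition `θ_{ks}(Ψ̃^* Ψ) < c`. -/
def ObliqueAlg.threshold : ObliqueAlg → ℝ
  | .obSP => 0.325
  | .obCoSaMP => 0.384
  | .obHTP => 0.577

end

/-!
Write `F = Ψ̃^* Ψ` and `ζ = Ψ̃^* z`. Once the arguments are recast in terms of `F` and `ζ`, all that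
matters is that, on every set of at most `ks` indices, `F` is within `c` of the identity and `ζ` has
norm at most a constant times `‖z‖` (`nearIdentity_of_rboc_lt`). No symmetry of `F` is used.

* Since `c < 1`, the oblique least squares problem on `J` is solved with zero residual. The error on
  `J` is then at most `c` times the total error, so that the total error is at most
  `‖x⋆_{Jᶜ}‖ / √(1 - c²)`, up to noise (`NearIdentity.norm_error_le`).
* Thresholding a perturbation of a vector `r` misses at most `√2` times the size of the
  perturbation (`IsHardThreshold.norm_restr_missed_le`).

Combining the two, one iteration of each algorithm contracts the error by a fixed factor below `1`,
up to noise, and the new error is at most a constant times the norm of the signal entries missed by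
the new support (`ErrorBounds`).

Contraction alone would give a number of iterations depending on the ratio of the initial error to
the noise. A count depending on `s` only is obtained as follows (`iterations_mul_le`). Let `e_t` be
the error at time `t`, well above the noise. An index `i` missed at time `t` has `|x⋆_i| ≤ e_t`, and
the error is at most `D ‖x⋆_{missed}‖`, whence `1 ≤ D² ∑ (|x⋆_i| / e_t)²`, the sum being over the
indices of the support with `|x⋆_i| ≤ e_t`. Sum over `t` and exchange the sums: because `e_t` decays
geometrically, each `i` contributes at most a geometric series, so the number of such times is
`O(s)`. Once the error is at noise level, the contraction keeps it there.
-/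

/-! ### Restriction of vectors to index sets -/

/-- The coordinate restriction `x_J`, kept in the full space: the entries outside `J` are set to
zero. -/
def restr {𝕜 : Type*} [RCLike 𝕜] {n : ℕ} (J : Finset (Fin n)) :
    EuclideanSpace 𝕜 (Fin n) →ₗ[𝕜] EuclideanSpace 𝕜 (Fin n) where
  toFun x := WithLp.toLp 2 fun i => if i ∈ J then x i else 0
  map_add' x y := by
    ext i
    by_cases h : i ∈ J <;> simp [h]
  map_smul' a x := by
    ext i
    by_cases h : i ∈ J <;> simp [h]

section Restriction

variable {𝕜 : Type*} [RCLike 𝕜] {n : ℕ}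

@[simp] theorem restr_apply (J : Finset (Fin n)) (x : EuclideanSpace 𝕜 (Fin n)) (i : Fin n) :
    restr J x i = if i ∈ J then x i else 0 := rfl

@[simp] theorem mem_vecSupp {x : EuclideanSpace 𝕜 (Fin n)} {i : Fin n} :
    i ∈ vecSupp x ↔ x i ≠ 0 := by
  simp [vecSupp]

theorem vecSupp_subset_iff {x : EuclideanSpace 𝕜 (Fin n)} {J : Finset (Fin n)} :
    vecSupp x ⊆ J ↔ ∀ i, i ∉ J → x i = 0 := by
  simp only [Finset.subset_iff, mem_vecSupp]
  exact forall_congr' fun i => not_imp_comm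

theorem vecSupp_restr_subset (J : Finset (Fin n)) (x : EuclideanSpace 𝕜 (Fin n)) :
    vecSupp (restr J x) ⊆ J :=
  vecSupp_subset_iff.2 fun i hi => by simp [hi]

theorem vecSupp_sub_subset {x y : EuclideanSpace 𝕜 (Fin n)} {J : Finset (Fin n)}
    (hx : vecSupp x ⊆ J) (hy : vecSupp y ⊆ J) : vecSupp (x - y) ⊆ J := by
  rw [vecSupp_subset_iff] at *
  intro i hi
  simp [hx i hi, hy i hi]

theorem restr_eq_self {x : EuclideanSpace 𝕜 (Fin n)} {J : Finset (Fin n)} (h : vecSupp x ⊆ J) :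
    restr J x = x := by
  rw [vecSupp_subset_iff] at h
  ext i
  by_cases hi : i ∈ J
  · simp [hi]
  · simp [hi, h i hi]

theorem norm_restr_sq (J : Finset (Fin n)) (x : EuclideanSpace 𝕜 (Fin n)) :
    ‖restr J x‖ ^ 2 = ∑ i ∈ J, ‖x i‖ ^ 2 := by
  rw [EuclideanSpace.norm_sq_eq]
  simp only [restr_apply, apply_ite norm, norm_zero, ite_pow]
  simp [Finset.sum_ite_mem]

theorem norm_restr_union_sq {A B : Finset (Fin n)} (h : Disjoint A B)
    (x : EuclideanSpace 𝕜 (Fin n)) :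
    ‖restr (A ∪ B) x‖ ^ 2 = ‖restr A x‖ ^ 2 + ‖restr B x‖ ^ 2 := by
  simp only [norm_restr_sq, Finset.sum_union h]

theorem norm_sq_eq_restr_add_compl (J : Finset (Fin n)) (x : EuclideanSpace 𝕜 (Fin n)) :
    ‖x‖ ^ 2 = ‖restr J x‖ ^ 2 + ‖restr Jᶜ x‖ ^ 2 := by
  rw [norm_restr_sq, norm_restr_sq, EuclideanSpace.norm_sq_eq, Finset.sum_add_sum_compl]

theorem norm_restr_mono {A B : Finset (Fin n)} (h : A ⊆ B) (x : EuclideanSpace 𝕜 (Fin n)) :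
    ‖restr A x‖ ≤ ‖restr B x‖ := by
  refine le_of_sq_le_sq ?_ (norm_nonneg _)
  simp only [norm_restr_sq]
  exact Finset.sum_le_sum_of_subset_of_nonneg h fun _ _ _ => by positivity

theorem norm_restr_le (J : Finset (Fin n)) (x : EuclideanSpace 𝕜 (Fin n)) :
    ‖restr J x‖ ≤ ‖x‖ := by
  refine le_of_sq_le_sq ?_ (norm_nonneg _)
  rw [norm_sq_eq_restr_add_compl J x]
  nlinarith [sq_nonneg ‖restr Jᶜ x‖]

theorem restr_congr {A : Finset (Fin n)} {x y : EuclideanSpace 𝕜 (Fin n)}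
    (h : ∀ i ∈ A, x i = y i) : restr A x = restr A y := by
  ext i
  by_cases hi : i ∈ A <;> simp [hi, h]

theorem norm_apply_le (x : EuclideanSpace 𝕜 (Fin n)) (i : Fin n) : ‖x i‖ ≤ ‖x‖ :=
  PiLp.norm_apply_le x i

/-- The restriction to `J` is the orthogonal projection onto the vectors supported in `J`. -/
theorem inner_restr_self (J : Finset (Fin n)) (x : EuclideanSpace 𝕜 (Fin n)) :
    inner 𝕜 (restr J x) x = ((‖restr J x‖ ^ 2 : ℝ) : 𝕜) := by
  rw [norm_restr_sq, PiLp.inner_apply]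
  push_cast
  rw [← Finset.sum_subset (Finset.subset_univ J) fun i _ hi => by simp [hi]]
  refine Finset.sum_congr rfl fun i hi => ?_
  simp [hi]

end Restriction

/-! ### The restricted near-identity model -/

section Model

variable {𝕜 : Type*} [RCLike 𝕜] {m n : ℕ}

/-- The two facts about the normal map `F = Ψ̃^* Ψ` and the back-projected noise `ζ = Ψ̃^* z` on
which the analysis rests: on every set of at most `r` indices, `F` is within `c` of the identity
and `ζ` has norm at most `ν`. -/
structure NearIdentity (r : ℕ) (c ν : ℝ)
    (F : EuclideanSpace 𝕜 (Fin n) →ₗ[𝕜] EuclideanSpace 𝕜 (Fin n))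
    (ζ : EuclideanSpace 𝕜 (Fin n)) : Prop where
  map_le : ∀ J : Finset (Fin n), J.card ≤ r → ∀ u : EuclideanSpace 𝕜 (Fin n), vecSupp u ⊆ J →
    ‖restr J (F u - u)‖ ≤ c * ‖u‖
  noise_le : ∀ J : Finset (Fin n), J.card ≤ r → ‖restr J ζ‖ ≤ ν

theorem toEuclideanLin_mul_apply {l : ℕ} (A : Matrix (Fin l) (Fin m) 𝕜)
    (B : Matrix (Fin m) (Fin n) 𝕜) (x : EuclideanSpace 𝕜 (Fin n)) :
    Matrix.toEuclideanLin (A * B) x = Matrix.toEuclideanLin A (Matrix.toEuclideanLin B x) := by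
  ext i
  simp [Matrix.toLpLin_apply]

theorem inner_toEuclideanLin_conjTranspose (A : Matrix (Fin m) (Fin n) 𝕜)
    (u : EuclideanSpace 𝕜 (Fin n)) (z : EuclideanSpace 𝕜 (Fin m)) :
    inner 𝕜 u (Matrix.toEuclideanLin A.conjTranspose z) =
      inner 𝕜 (Matrix.toEuclideanLin A u) z := by
  rw [Matrix.toEuclideanLin_conjTranspose_eq_adjoint, LinearMap.adjoint_inner_right]

/-- A bound on the sesquilinear form of `F - 1` over a common support bounds the restricted norm:
test against `v = (F u - u)_J`. -/
theorem norm_restr_sub_le_of_inner_le {J : Finset (Fin n)} {c : ℝ}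
    {f u : EuclideanSpace 𝕜 (Fin n)}
    (h : ∀ v : EuclideanSpace 𝕜 (Fin n), vecSupp v ⊆ J →
      ‖inner 𝕜 v f - inner 𝕜 v u‖ ≤ c * ‖u‖ * ‖v‖) (hc : 0 ≤ c) :
    ‖restr J (f - u)‖ ≤ c * ‖u‖ := by
  have key := h (restr J (f - u)) (vecSupp_restr_subset _ _)
  rw [← inner_sub_right, inner_restr_self, RCLike.norm_ofReal, abs_of_nonneg (by positivity)] at key
  rcases (norm_nonneg (restr J (f - u))).eq_or_lt with h0 | h0
  · rw [← h0]; positivity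
  · nlinarith

/-- The defining set of the biorthogonality constant is nonempty, so that a strict upper bound of
its infimum is also a bound for the form. -/
theorem norm_restr_sub_le_of_rboc_lt {r : ℕ} {c : ℝ} {M : Matrix (Fin n) (Fin n) 𝕜}
    (h : rboc r M < c) {J : Finset (Fin n)} (hJ : J.card ≤ r) {u : EuclideanSpace 𝕜 (Fin n)}
    (hu : vecSupp u ⊆ J) : ‖restr J (Matrix.toEuclideanLin M u - u)‖ ≤ c * ‖u‖ := by
  obtain ⟨δ, ⟨hδ, hδ'⟩, hlt⟩ := exists_lt_of_csInf_lt (by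
    let f := LinearMap.toContinuousLinearMap (Matrix.toEuclideanLin M)
    refine ⟨‖f - 1‖, norm_nonneg _, fun J _ x y _ _ => ?_⟩
    rw [← inner_sub_right]
    calc _ ≤ ‖y‖ * ‖(f - 1) x‖ := norm_inner_le_norm y ((f - 1) x)
      _ ≤ ‖y‖ * (‖f - 1‖ * ‖x‖) := by gcongr; exact ContinuousLinearMap.le_opNorm _ _
      _ = _ := by ring) h
  refine (norm_restr_sub_le_of_inner_le (fun v hv => hδ' J hJ u v hu hv) hδ).trans ?_
  gcongr

/-- The slack `2` in place of `1` avoids having to know that the infimum is attained. -/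
theorem norm_sq_toEuclideanLin_le_of_isSparse (r : ℕ) (A : Matrix (Fin m) (Fin n) 𝕜)
    {u : EuclideanSpace 𝕜 (Fin n)} (hu : IsSparse r u) :
    ‖Matrix.toEuclideanLin A u‖ ^ 2 ≤ (2 + ric r A) * ‖u‖ ^ 2 := by
  obtain ⟨δ, ⟨_, hδ⟩, hlt⟩ := exists_lt_of_csInf_lt (b := ric r A + 1) (by
    let f := LinearMap.toContinuousLinearMap (Matrix.toEuclideanLin A)
    refine ⟨‖f‖ ^ 2 + 1, by positivity, fun x _ => ⟨?_, ?_⟩⟩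
    · nlinarith [sq_nonneg ‖Matrix.toEuclideanLin A x‖, sq_nonneg (‖f‖ * ‖x‖)]
    · have : ‖Matrix.toEuclideanLin A x‖ ≤ ‖f‖ * ‖x‖ := f.le_opNorm x
      have := pow_le_pow_left₀ (norm_nonneg _) this 2
      nlinarith [sq_nonneg ‖x‖]) (lt_add_one (ric r A))
  exact (hδ u hu).2.trans (mul_le_mul_of_nonneg_right (by linarith) (sq_nonneg _))

theorem norm_restr_conjTranspose_le (r : ℕ) (A : Matrix (Fin m) (Fin n) 𝕜)
    (z : EuclideanSpace 𝕜 (Fin m)) {J : Finset (Fin n)} (hJ : J.card ≤ r) :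
    ‖restr J (Matrix.toEuclideanLin A.conjTranspose z)‖ ≤ √(2 + ric r A) * ‖z‖ := by
  set v := restr J (Matrix.toEuclideanLin A.conjTranspose z) with hv
  have h1 : ‖v‖ ^ 2 ≤ ‖Matrix.toEuclideanLin A v‖ * ‖z‖ := by
    have h := norm_inner_le_norm (𝕜 := 𝕜) (Matrix.toEuclideanLin A v) z
    rwa [← inner_toEuclideanLin_conjTranspose, hv, inner_restr_self, RCLike.norm_ofReal,
      abs_of_nonneg (by positivity)] at h
  have hr : 0 ≤ ric r A := Real.sInf_nonneg fun δ hδ => hδ.1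
  have h2 : ‖Matrix.toEuclideanLin A v‖ ≤ √(2 + ric r A) * ‖v‖ := by
    rw [← Real.sqrt_sq (norm_nonneg v), ← Real.sqrt_mul (by positivity)]
    exact Real.le_sqrt_of_sq_le (norm_sq_toEuclideanLin_le_of_isSparse r A
      ((Finset.card_le_card (vecSupp_restr_subset _ _)).trans hJ))
  rcases (norm_nonneg v).eq_or_lt with h0 | h0
  · rw [← h0]; positivity
  · have := mul_le_mul_of_nonneg_right h2 (norm_nonneg z)
    nlinarith

theorem nearIdentity_of_rboc_lt {r : ℕ} {c : ℝ} {Ψ Ψt : Matrix (Fin m) (Fin n) 𝕜}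
    (h : rboc r (Ψt.conjTranspose * Ψ) < c) (z : EuclideanSpace 𝕜 (Fin m)) :
    NearIdentity r c (√(2 + ric r Ψt) * ‖z‖) (Matrix.toEuclideanLin (Ψt.conjTranspose * Ψ))
      (Matrix.toEuclideanLin Ψt.conjTranspose z) :=
  ⟨fun _ hJ _ hu => norm_restr_sub_le_of_rboc_lt h hJ hu,
    fun _ hJ => norm_restr_conjTranspose_le r Ψt z hJ⟩

theorem proxy_eq (Ψ Ψt : Matrix (Fin m) (Fin n) 𝕜) (xstar x : EuclideanSpace 𝕜 (Fin n))
    (z : EuclideanSpace 𝕜 (Fin m)) :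
    proxy Ψ Ψt (Matrix.toEuclideanLin Ψ xstar + z) x =
      Matrix.toEuclideanLin (Ψt.conjTranspose * Ψ) (xstar - x) +
        Matrix.toEuclideanLin Ψt.conjTranspose z := by
  rw [proxy, toEuclideanLin_mul_apply, map_sub, map_sub, map_sub, map_add]
  abel

end Model

/-! ### Oblique least squares -/

section LeastSquares

variable {𝕜 : Type*} [RCLike 𝕜] {m n : ℕ}

theorem norm_colSub_conjTranspose (A : Matrix (Fin m) (Fin n) 𝕜) (J : Finset (Fin n))
    (w : EuclideanSpace 𝕜 (Fin m)) :
    ‖Matrix.toEuclideanLin (colSub A J).conjTranspose w‖ =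
      ‖restr J (Matrix.toEuclideanLin A.conjTranspose w)‖ := by
  refine (sq_eq_sq₀ (norm_nonneg _) (norm_nonneg _)).1 ?_
  rw [norm_restr_sq, EuclideanSpace.norm_sq_eq, ← Finset.sum_coe_sort J]
  rfl

/-- The compression of `F` to the vectors supported in `J` is injective, hence bijective, because
`F` is within `c < 1` of the identity there. -/
theorem NearIdentity.exists_restr_eq {r : ℕ} {c ν : ℝ}
    {F : EuclideanSpace 𝕜 (Fin n) →ₗ[𝕜] EuclideanSpace 𝕜 (Fin n)}
    {ζ : EuclideanSpace 𝕜 (Fin n)} (H : NearIdentity r c ν F ζ) (hc : c < 1)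
    {J : Finset (Fin n)} (hJ : J.card ≤ r) (g : EuclideanSpace 𝕜 (Fin n)) :
    ∃ w : EuclideanSpace 𝕜 (Fin n), vecSupp w ⊆ J ∧ restr J (F w) = restr J g := by
  -- extend the compression by the identity off `J` to get an endomorphism of the full space
  let L : EuclideanSpace 𝕜 (Fin n) →ₗ[𝕜] EuclideanSpace 𝕜 (Fin n) :=
    restr Jᶜ + restr J ∘ₗ F ∘ₗ restr J
  have hL : ∀ u i, L u i = if i ∈ J then F (restr J u) i else u i := fun u i => by
    by_cases hi : i ∈ J <;> simp [L, hi]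
  have hinj : Function.Injective L := by
    rw [injective_iff_map_eq_zero]
    intro u hu
    have hi : ∀ i, (if i ∈ J then F (restr J u) i else u i) = 0 := fun i => by
      rw [← hL, hu]; rfl
    have hsupp : vecSupp u ⊆ J := vecSupp_subset_iff.2 fun i hiJ => by simpa [hiJ] using hi i
    have hF : restr J (F u) = 0 := by
      ext i
      by_cases hiJ : i ∈ J
      · simpa [hiJ, restr_eq_self hsupp] using hi i
      · simp [hiJ]
    have := H.map_le J hJ u hsupp
    rw [map_sub, hF, zero_sub, norm_neg, restr_eq_self hsupp] at this
    exact norm_le_zero_iff.1 (by nlinarith [norm_nonneg u])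
  obtain ⟨w, hw⟩ := (LinearMap.injective_iff_surjective.1 hinj) (restr J g)
  have hi : ∀ i, (if i ∈ J then F (restr J w) i else w i) = restr J g i := fun i => by
    rw [← hL, hw]
  have hsupp : vecSupp w ⊆ J := vecSupp_subset_iff.2 fun i hiJ => by simpa [hiJ] using hi i
  refine ⟨w, hsupp, ?_⟩
  ext i
  by_cases hiJ : i ∈ J
  · simpa [hiJ, restr_eq_self hsupp] using hi i
  · simp [hiJ]

/-- The oblique least squares residual is zero: the proxy of the minimizer vanishes on `J`. -/
theorem IsObliqueLS.restr_eq_zero {r : ℕ} {c ν : ℝ} {Ψ Ψt : Matrix (Fin m) (Fin n) 𝕜}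
    {xstar x : EuclideanSpace 𝕜 (Fin n)} {z : EuclideanSpace 𝕜 (Fin m)} {J : Finset (Fin n)}
    (h : IsObliqueLS Ψ Ψt (Matrix.toEuclideanLin Ψ xstar + z) J x)
    (H : NearIdentity r c ν (Matrix.toEuclideanLin (Ψt.conjTranspose * Ψ))
      (Matrix.toEuclideanLin Ψt.conjTranspose z)) (hc : c < 1) (hJ : J.card ≤ r) :
    restr J (Matrix.toEuclideanLin (Ψt.conjTranspose * Ψ) (xstar - x) +
      Matrix.toEuclideanLin Ψt.conjTranspose z) = 0 := by
  obtain ⟨w, hw, hw'⟩ := H.exists_restr_eq hc hJ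
    (Matrix.toEuclideanLin (Ψt.conjTranspose * Ψ) xstar + Matrix.toEuclideanLin Ψt.conjTranspose z)
  have hmin := h.2 w hw
  rw [norm_colSub_conjTranspose, norm_colSub_conjTranspose] at hmin
  change ‖restr J (proxy _ _ _ _)‖ ≤ ‖restr J (proxy _ _ _ _)‖ at hmin
  rw [proxy_eq, proxy_eq] at hmin
  refine norm_le_zero_iff.1 (hmin.trans (le_of_eq ?_))
  rw [norm_eq_zero, map_sub, sub_add_eq_add_sub, map_sub, hw', sub_self]

variable {r : ℕ} {c ν : ℝ} {F : EuclideanSpace 𝕜 (Fin n) →ₗ[𝕜] EuclideanSpace 𝕜 (Fin n)}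
  {ζ xstar x : EuclideanSpace 𝕜 (Fin n)} {J S : Finset (Fin n)}

theorem NearIdentity.norm_restr_map_sub_add_le (H : NearIdentity r c ν F ζ) (hJ : J.card ≤ r)
    {A : Finset (Fin n)} (hA : A ⊆ J) {u : EuclideanSpace 𝕜 (Fin n)} (hu : vecSupp u ⊆ J) :
    ‖restr A (F u - u + ζ)‖ ≤ c * ‖u‖ + ν := by
  refine (norm_restr_mono hA _).trans ?_
  rw [map_add]
  exact (norm_add_le _ _).trans (add_le_add (H.map_le J hJ u hu) (H.noise_le J hJ))

theorem NearIdentity.noise_nonneg (H : NearIdentity r c ν F ζ) : 0 ≤ ν :=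
  (norm_nonneg _).trans (H.noise_le ∅ (by simp))

/-- If the proxy at `x` vanishes on `J`, the error of `x` on `J` is at most `c` times the total
error, up to noise. -/
theorem NearIdentity.norm_restr_error_le (H : NearIdentity r c ν F ζ)
    (hS : vecSupp xstar ⊆ S) (hx : vecSupp x ⊆ J) (hcard : (J ∪ S).card ≤ r)
    (h0 : restr J (F (xstar - x) + ζ) = 0) :
    ‖restr J (xstar - x)‖ ≤ c * ‖xstar - x‖ + ν := by
  have h := H.norm_restr_map_sub_add_le hcard (A := J) Finset.subset_union_left
    (u := xstar - x) (vecSupp_sub_subset (hS.trans Finset.subset_union_right)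
      (hx.trans Finset.subset_union_left))
  rwa [sub_add_eq_add_sub, map_sub, h0, zero_sub, norm_neg] at h

theorem norm_sub_sq_eq_of_vecSupp_subset (hx : vecSupp x ⊆ J) :
    ‖xstar - x‖ ^ 2 = ‖restr J (xstar - x)‖ ^ 2 + ‖restr Jᶜ xstar‖ ^ 2 := by
  rw [norm_sq_eq_restr_add_compl J]
  congr 3
  refine restr_congr fun i hi => ?_
  simp [vecSupp_subset_iff.1 hx i (by simpa using hi)]

/-- From `e² ≤ (c e + ν)² + m²`, completing the square gives `e ≤ m / √(1 - c²) + ν / (1 - c)`;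
here `a` is any upper bound of `1 / √(1 - c²)`. -/
theorem le_of_sq_le_add_sq {e c ν m a : ℝ} (hm : 0 ≤ m) (hν : 0 ≤ ν) (hc : c < 1)
    (ha0 : 0 ≤ a) (ha : 1 ≤ a ^ 2 * (1 - c ^ 2)) (h : e ^ 2 ≤ (c * e + ν) ^ 2 + m ^ 2) :
    e ≤ a * m + ν / (1 - c) := by
  set b := ν / (1 - c) with hb
  have hbν : ν = b * (1 - c) := by
    rw [hb, div_mul_cancel₀]
    linarith
  have hb0 : 0 ≤ b := div_nonneg hν (by linarith)
  by_contra! hlt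
  -- with `ν = (1 - c) b`, the hypothesis factors as
  -- `(1 - c) (e - b) ((1 + c) e + (1 - c) b) ≤ m²`, which bounds `(1 - c²) (e - b)²`
  rw [hbν] at h
  have h1 : 0 < 1 - c := by linarith
  have h2 : (1 - c) * ((e - b) * ((1 + c) * e + (1 - c) * b)) ≤ m ^ 2 := by nlinarith
  have h3 : a * m < e - b := by linarith
  have ham : 0 ≤ a * m := by positivity
  have h4 : (1 + c) * (e - b) ≤ (1 + c) * e + (1 - c) * b := by nlinarith
  have h5 : (1 - c) * ((e - b) * ((1 + c) * (e - b))) ≤ m ^ 2 := by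
    refine le_trans ?_ h2
    have : 0 ≤ e - b := by linarith
    gcongr
  have h6 : (a * m) ^ 2 < (e - b) ^ 2 := by
    exact pow_lt_pow_left₀ h3 ham two_ne_zero
  have h7 : 0 < 1 - c ^ 2 := by nlinarith
  have h8 : (1 - c ^ 2) * (a * m) ^ 2 < (1 - c ^ 2) * (e - b) ^ 2 := by gcongr
  nlinarith [mul_le_mul_of_nonneg_right ha (sq_nonneg m)]

/-- Least squares on `J` reduces the error to the part of the signal missed by `J`. -/
theorem NearIdentity.norm_error_le (H : NearIdentity r c ν F ζ) (hc : c < 1)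
    (hS : vecSupp xstar ⊆ S) (hx : vecSupp x ⊆ J) (hcard : (J ∪ S).card ≤ r)
    (h0 : restr J (F (xstar - x) + ζ) = 0) {a : ℝ} (ha0 : 0 ≤ a)
    (ha : 1 ≤ a ^ 2 * (1 - c ^ 2)) :
    ‖xstar - x‖ ≤ a * ‖restr Jᶜ xstar‖ + ν / (1 - c) := by
  refine le_of_sq_le_add_sq (norm_nonneg _) H.noise_nonneg hc ha0 ha ?_
  rw [norm_sub_sq_eq_of_vecSupp_subset hx]
  gcongr
  exact H.norm_restr_error_le hS hx hcard h0

end LeastSquares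

/-! ### Hard thresholding -/

section Threshold

variable {𝕜 : Type*} [RCLike 𝕜] {n k : ℕ}

theorem isSparse_of_vecSupp_subset {x : EuclideanSpace 𝕜 (Fin n)} {J : Finset (Fin n)}
    (h : vecSupp x ⊆ J) (hJ : J.card ≤ k) : IsSparse k x :=
  (Finset.card_le_card h).trans hJ

theorem sub_restr (J : Finset (Fin n)) (x : EuclideanSpace 𝕜 (Fin n)) :
    x - restr J x = restr Jᶜ x := by
  ext i
  by_cases hi : i ∈ J <;> simp [hi]

/-- Entries kept by thresholding are nonzero entries of the input: dropping the others from the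
output would bring it closer. -/
theorem IsHardThreshold.vecSupp_subset {v w : EuclideanSpace 𝕜 (Fin n)}
    (h : IsHardThreshold k v w) : vecSupp w ⊆ vecSupp v := by
  have hmin := h.2 (restr (vecSupp v) w) <| by
    refine isSparse_of_vecSupp_subset (J := vecSupp w) (vecSupp_subset_iff.2 fun i hi => ?_) h.1
    simp_all
  have hv : ∀ i, i ∉ vecSupp v → v i = 0 := fun i hi => by simpa using hi
  have hsq := pow_le_pow_left₀ (norm_nonneg _) hmin 2
  rw [norm_sq_eq_restr_add_compl (vecSupp v) (v - w),
    norm_sq_eq_restr_add_compl (vecSupp v) (v - restr (vecSupp v) w),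
    restr_congr (A := vecSupp v) (x := v - restr (vecSupp v) w) (y := v - w)
      fun i hi => by simp [mem_vecSupp.1 hi],
    restr_congr (A := (vecSupp v)ᶜ) (x := v - restr (vecSupp v) w) (y := 0)
      fun i hi => by simp [hv i (by simpa using hi)],
    restr_congr (A := (vecSupp v)ᶜ) (x := v - w) (y := -w)
      fun i hi => by simp [hv i (by simpa using hi)]] at hsq
  have h0 : ‖restr (vecSupp v)ᶜ (-w)‖ = 0 := by
    rw [map_zero, norm_zero] at hsq
    nlinarith [norm_nonneg (restr (vecSupp v)ᶜ (-w))]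
  refine vecSupp_subset_iff.2 fun i hi => ?_
  have := congrArg (fun y : EuclideanSpace 𝕜 (Fin n) => y i) (norm_eq_zero.1 h0)
  simpa [hv i hi] using this

/-- The support of `H_k(v)` carries at least as much of `v` as any other set of `k` indices; the
common part of the two sets is removed on both sides. -/
theorem IsHardThreshold.norm_restr_sdiff_le {v w : EuclideanSpace 𝕜 (Fin n)}
    (h : IsHardThreshold k v w) {S : Finset (Fin n)} (hS : S.card ≤ k) :
    ‖restr (S \ vecSupp w) v‖ ≤ ‖restr (vecSupp w \ S) v‖ := by
  set T := vecSupp w with hT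
  have h1 : ‖restr Tᶜ v‖ ≤ ‖restr Sᶜ v‖ := by
    have hmin := h.2 (restr S v) (isSparse_of_vecSupp_subset (vecSupp_restr_subset S v) hS)
    rw [sub_restr] at hmin
    refine le_trans ?_ hmin
    rw [restr_congr (A := Tᶜ) (x := v) (y := v - w) fun i hi => by
      have : w i = 0 := by simpa [hT] using hi
      simp [this]]
    exact norm_restr_le _ _
  have hTc : Tᶜ = (S \ T) ∪ (S ∪ T)ᶜ := by ext i; simp; tauto
  have hSc : Sᶜ = (T \ S) ∪ (S ∪ T)ᶜ := by ext i; simp; tauto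
  have h2 := pow_le_pow_left₀ (norm_nonneg _) h1 2
  rw [hTc, hSc, norm_restr_union_sq, norm_restr_union_sq] at h2
  · exact le_of_sq_le_sq (by linarith) (norm_nonneg _)
  all_goals
    rw [Finset.disjoint_left]
    intro i
    simp
    tauto

/-- If `v = r + w`, where `r` is supported on a competing set `S`, then the part of `r` missed by
the support of `H_k(v)` is controlled by the perturbation `w`, with the factor `√2` coming from
the two disjoint sets on which `w` is tested. -/
theorem IsHardThreshold.norm_restr_missed_le {v h r w : EuclideanSpace 𝕜 (Fin n)}
    (hh : IsHardThreshold k v h) (hv : v = r + w) {S B : Finset (Fin n)} (hS : S.card ≤ k)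
    (hr : ∀ i ∈ vecSupp h, i ∉ S → r i = 0) (hB : S ∪ vecSupp h ⊆ B) :
    ‖restr (S \ vecSupp h) r‖ ≤ √2 * ‖restr B w‖ := by
  set T := vecSupp h
  have h1 : ‖restr (S \ T) r‖ ≤ ‖restr (T \ S) w‖ + ‖restr (S \ T) w‖ := by
    have e : restr (S \ T) r = restr (S \ T) v - restr (S \ T) w := by
      rw [hv, map_add, add_sub_cancel_right]
    have e' : restr (T \ S) v = restr (T \ S) w := restr_congr fun i hi => by
      rw [Finset.mem_sdiff] at hi
      simp [hv, hr i hi.1 hi.2]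
    rw [e, ← e']
    exact (norm_sub_le _ _).trans (add_le_add_left (hh.norm_restr_sdiff_le hS) _)
  have hd : Disjoint (T \ S) (S \ T) := disjoint_sdiff_sdiff
  have h2 : ‖restr (T \ S) w‖ ^ 2 + ‖restr (S \ T) w‖ ^ 2 ≤ ‖restr B w‖ ^ 2 := by
    rw [← norm_restr_union_sq hd]
    gcongr
    refine norm_restr_mono (subset_trans ?_ hB) w
    intro i
    simp
    tauto
  refine h1.trans (le_of_sq_le_sq ?_ (by positivity))
  rw [mul_pow, Real.sq_sqrt zero_le_two]
  nlinarith [sq_nonneg (‖restr (T \ S) w‖ - ‖restr (S \ T) w‖)]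

end Threshold

/-! ### One iteration of each algorithm -/

section Steps

variable {𝕜 : Type*} [RCLike 𝕜] {n s : ℕ} {ν : ℝ}
  {F : EuclideanSpace 𝕜 (Fin n) →ₗ[𝕜] EuclideanSpace 𝕜 (Fin n)}
  {ζ xstar x x' xt h hs : EuclideanSpace 𝕜 (Fin n)}

/-- The outcome of one iteration `x ↦ x'`: the new error is controlled by the part of the signal
missed by some set containing the support of `x'`, and the error contracts, both up to noise. The
constants are common to the three algorithms; the contraction factor is dictated by oblique hard
thresholding pursuit, whose threshold is the tightest. -/
def ErrorBounds (ν : ℝ) (xstar x x' : EuclideanSpace 𝕜 (Fin n)) : Prop :=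
  ∃ J : Finset (Fin n), vecSupp x' ⊆ J ∧ ‖xstar - x'‖ ≤ 3 * ‖restr Jᶜ xstar‖ + 100 * ν ∧
    ‖xstar - x'‖ ≤ 0.9995 * ‖xstar - x‖ + 100 * ν

theorem sqrt_two_le : √2 ≤ 1.41422 := by
  rw [Real.sqrt_le_left (by norm_num)]
  norm_num

theorem le_of_sq_le_sq_add_sq {X m q κ l f : ℝ} (hm : 0 ≤ m) (hq : 0 ≤ q) (hl : 0 ≤ l)
    (hf : 0 ≤ f) (hκf : 1 + κ ^ 2 ≤ f ^ 2) (hqm : q ≤ κ * m + l)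
    (h : X ^ 2 ≤ m ^ 2 + q ^ 2) : X ≤ f * m + l := by
  refine le_of_sq_le_sq ?_ (by positivity)
  have h1 : q ^ 2 ≤ (κ * m + l) ^ 2 := pow_le_pow_left₀ hq hqm 2
  have h2 : κ ≤ f := le_of_sq_le_sq (by linarith) hf
  have h3 : κ * (m * l) ≤ f * (m * l) := mul_le_mul_of_nonneg_right h2 (by positivity)
  have h4 := mul_le_mul_of_nonneg_right hκf (sq_nonneg m)
  nlinarith

theorem restr_sdiff_vecSupp (J : Finset (Fin n)) :
    restr (vecSupp xstar \ J) xstar = restr Jᶜ xstar := by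
  ext i
  by_cases hi : i ∈ J <;> simp +contextual [hi]

theorem card_union_le_add {A B : Finset (Fin n)} {a b c : ℕ} (hA : A.card ≤ a) (hB : B.card ≤ b)
    (hc : a + b ≤ c) : (A ∪ B).card ≤ c :=
  (Finset.card_union_le A B).trans ((add_le_add hA hB).trans hc)

/-- The noiseless contraction factor is `√2 c / √(1 - c²)`, which is below `1` for `c < 1 / √3`. -/
theorem errorBounds_of_obHTP (H : NearIdentity (3 * s) 0.577 ν F ζ) (hstar : IsSparse s xstar)
    (hx : IsSparse s x) (hh : IsHardThreshold s (x + (F (xstar - x) + ζ)) h)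
    (hx' : vecSupp x' ⊆ vecSupp h) (h0 : restr (vecSupp h) (F (xstar - x') + ζ) = 0) :
    ErrorBounds ν xstar x x' := by
  have hν := H.noise_nonneg
  have hT : (vecSupp h).card ≤ s := hh.1
  have hm : ‖restr (vecSupp h)ᶜ xstar‖ ≤ 1.41422 * (0.577 * ‖xstar - x‖ + ν) := by
    rw [← restr_sdiff_vecSupp]
    refine (hh.norm_restr_missed_le (r := xstar) (w := F (xstar - x) - (xstar - x) + ζ)
      (by abel) hstar (fun i _ hi => by simpa using hi) subset_rfl).trans
      (mul_le_mul sqrt_two_le ?_ (norm_nonneg _) (by norm_num))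
    refine H.norm_restr_map_sub_add_le (J := vecSupp xstar ∪ vecSupp h ∪ vecSupp x)
      (card_union_le_add (card_union_le_add hstar hT le_rfl) hx (by omega))
      Finset.subset_union_left (vecSupp_sub_subset ?_ Finset.subset_union_right)
    exact Finset.subset_union_left.trans Finset.subset_union_left
  have he := H.norm_error_le (by norm_num) subset_rfl hx'
    (card_union_le_add hT hstar (by omega)) h0 (a := 1.2244) (by norm_num) (by norm_num)
  have hm0 := norm_nonneg (restr (vecSupp h)ᶜ xstar)
  have he0 := norm_nonneg (xstar - x)
  norm_num at he hm
  refine ⟨vecSupp h, hx', ?_, ?_⟩ <;> norm_num <;> linarith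

/-- The noiseless contraction factor is `√(2 c² (1 + 3 c²) / (1 - c²))`. -/
theorem errorBounds_of_obCoSaMP (H : NearIdentity (4 * s) 0.384 ν F ζ)
    (hstar : IsSparse s xstar) (hx : IsSparse s x)
    (hh : IsHardThreshold (2 * s) (F (xstar - x) + ζ) h) (hxt : vecSupp xt ⊆ vecSupp x ∪ vecSupp h)
    (h0 : restr (vecSupp x ∪ vecSupp h) (F (xstar - xt) + ζ) = 0)
    (hx' : IsHardThreshold s xt x') : ErrorBounds ν xstar x x' := by
  have hν := H.noise_nonneg
  have hT : (vecSupp h).card ≤ 2 * s := hh.1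
  have hSX : (vecSupp xstar ∪ vecSupp x).card ≤ 2 * s := card_union_le_add hstar hx (by omega)
  have hsub : vecSupp (xstar - x) ⊆ vecSupp xstar ∪ vecSupp x :=
    vecSupp_sub_subset Finset.subset_union_left Finset.subset_union_right
  set J := vecSupp x ∪ vecSupp h with hJ
  have hm : ‖restr Jᶜ xstar‖ ≤ 1.41422 * (0.384 * ‖xstar - x‖ + ν) := by
    -- off `J`, the signal agrees with the current error
    have e : restr Jᶜ xstar =
        restr Jᶜ (restr ((vecSupp xstar ∪ vecSupp x) \ vecSupp h) (xstar - x)) := by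
      ext i
      by_cases h1 : x i = 0 <;> by_cases h2 : h i = 0 <;> simp +contextual [hJ, h1, h2]
    rw [e]
    refine (norm_restr_le _ _).trans ((hh.norm_restr_missed_le (r := xstar - x)
      (w := F (xstar - x) - (xstar - x) + ζ) (by abel) hSX
      (fun i _ hi => vecSupp_subset_iff.1 hsub i hi) subset_rfl).trans
      (mul_le_mul sqrt_two_le ?_ (norm_nonneg _) (by norm_num)))
    exact H.norm_restr_map_sub_add_le (card_union_le_add hSX hT (by omega)) subset_rfl
      (hsub.trans Finset.subset_union_left)
  have hcard : (J ∪ vecSupp xstar).card ≤ 4 * s :=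
    card_union_le_add (card_union_le_add hx hT le_rfl) hstar (by omega)
  have hb := H.norm_error_le (by norm_num) subset_rfl hxt hcard h0 (a := 1.084)
    (by norm_num) (by norm_num)
  have hg := H.norm_restr_error_le subset_rfl hxt hcard h0
  have hx'J : vecSupp x' ⊆ J := hx'.vecSupp_subset.trans hxt
  -- on `J`, pruning at most doubles the error, since `xstar` restricted to `J` is a competitor
  have hp : ‖restr J (xstar - x')‖ ≤ 2 * ‖restr J (xstar - xt)‖ := by
    have hmin := hx'.2 (restr J xstar) <| by
      refine isSparse_of_vecSupp_subset (J := vecSupp xstar) (vecSupp_subset_iff.2 fun i hi => ?_)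
        hstar
      simp_all
    have e1 : restr J (xstar - x') = restr J (xstar - xt) + (xt - x') := by
      rw [map_sub, map_sub, restr_eq_self hxt, restr_eq_self hx'J]
      abel
    have e2 : ‖xt - restr J xstar‖ = ‖restr J (xstar - xt)‖ := by
      rw [map_sub, restr_eq_self hxt, norm_sub_rev]
    rw [e1]
    refine (norm_add_le _ _).trans ?_
    linarith
  have hm0 := norm_nonneg (restr Jᶜ xstar)
  have he0 := norm_nonneg (xstar - x)
  norm_num [-map_sub] at hb hm hg
  have hlast : ‖xstar - x'‖ ≤ 1.31 * ‖restr Jᶜ xstar‖ + 3.3 * ν := by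
    refine le_of_sq_le_sq_add_sq (q := ‖restr J (xstar - x')‖) (κ := 0.8326) hm0 (norm_nonneg _)
      (by positivity) (by norm_num) (by norm_num) (by norm_num [-map_sub]; linarith) ?_
    rw [norm_sub_sq_eq_of_vecSupp_subset hx'J, add_comm]
  norm_num at hlast
  refine ⟨J, hx'J, ?_, ?_⟩ <;> norm_num <;> linarith

/-- The noiseless contraction factor is `√(2 c² (1 + c²)) / (1 - c²)`. The hypothesis `hprev` says
that `x` is itself a least squares solution; it keeps the newly selected indices away from the
support of `x`. -/
theorem errorBounds_of_obSP (H : NearIdentity (3 * s) 0.325 ν F ζ)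
    (hstar : IsSparse s xstar) (hx : IsSparse s x)
    (hprev : restr (vecSupp x) (F (xstar - x) + ζ) = 0)
    (hh : IsHardThreshold s (F (xstar - x) + ζ) h) (hxt : vecSupp xt ⊆ vecSupp x ∪ vecSupp h)
    (h0 : restr (vecSupp x ∪ vecSupp h) (F (xstar - xt) + ζ) = 0)
    (hhs : IsHardThreshold s xt hs) (hx' : vecSupp x' ⊆ vecSupp hs)
    (h0' : restr (vecSupp hs) (F (xstar - x') + ζ) = 0) : ErrorBounds ν xstar x x' := by
  have hν := H.noise_nonneg
  have hT : (vecSupp h).card ≤ s := hh.1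
  have hJ' : (vecSupp hs).card ≤ s := hhs.1
  have hsub : vecSupp (xstar - x) ⊆ vecSupp xstar ∪ vecSupp x :=
    vecSupp_sub_subset Finset.subset_union_left Finset.subset_union_right
  have hTX : ∀ i ∈ vecSupp h, x i = 0 := fun i hi => by
    by_contra hxi
    have h1 := congrArg (fun y : EuclideanSpace 𝕜 (Fin n) => y i) hprev
    exact mem_vecSupp.1 (hh.vecSupp_subset hi) (by simpa [hxi] using h1)
  set J := vecSupp x ∪ vecSupp h with hJ
  have hm : ‖restr Jᶜ xstar‖ ≤ 1.41422 * (0.325 * ‖xstar - x‖ + ν) := by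
    have e : restr Jᶜ xstar = restr ((vecSupp xstar \ vecSupp x) \ vecSupp h) (xstar - x) := by
      ext i
      by_cases h1 : x i = 0 <;> by_cases h2 : h i = 0 <;> simp +contextual [hJ, h1, h2]
    rw [e]
    refine (hh.norm_restr_missed_le (r := xstar - x) (B := vecSupp xstar ∪ vecSupp x ∪ vecSupp h)
      (w := F (xstar - x) - (xstar - x) + ζ) (by abel)
      ((Finset.card_le_card Finset.sdiff_subset).trans hstar) (fun i hi hiS => ?_) ?_).trans
      (mul_le_mul sqrt_two_le ?_ (norm_nonneg _) (by norm_num))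
    · have := hTX i hi
      simp_all
    · exact Finset.union_subset_union_left (Finset.sdiff_subset.trans Finset.subset_union_left)
    · exact H.norm_restr_map_sub_add_le
        (card_union_le_add (card_union_le_add hstar hx le_rfl) hT (by omega)) subset_rfl
        (hsub.trans Finset.subset_union_left)
  have hcard : (J ∪ vecSupp xstar).card ≤ 3 * s :=
    card_union_le_add (card_union_le_add hx hT le_rfl) hstar (by omega)
  have hb := H.norm_error_le (by norm_num) subset_rfl hxt hcard h0 (a := 1.06)
    (by norm_num) (by norm_num)
  have hg := H.norm_restr_error_le subset_rfl hxt hcard h0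
  have hsJ : vecSupp hs ⊆ J := hhs.vecSupp_subset.trans hxt
  -- the part of the signal lost by pruning is governed by the error of `xt` on `J`
  have hq : ‖restr (J \ vecSupp hs) xstar‖ ≤ 1.41422 * ‖restr J (xstar - xt)‖ := by
    have e : restr (J \ vecSupp hs) xstar = restr ((vecSupp xstar ∩ J) \ vecSupp hs) xstar := by
      ext i
      by_cases h1 : xstar i = 0 <;> simp [h1]
    rw [e]
    refine (hhs.norm_restr_missed_le (r := xstar) (w := xt - xstar) (B := J) (by abel)
      ((Finset.card_le_card Finset.inter_subset_left).trans hstar) (fun i hi hiS => ?_)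
      (Finset.union_subset Finset.inter_subset_right hsJ)).trans ?_
    · by_contra h1
      exact hiS (Finset.mem_inter.2 ⟨mem_vecSupp.2 h1, hsJ hi⟩)
    · rw [← neg_sub xstar xt, map_neg, norm_neg]
      exact mul_le_mul_of_nonneg_right sqrt_two_le (norm_nonneg _)
  have hm0 := norm_nonneg (restr Jᶜ xstar)
  have he0 := norm_nonneg (xstar - x)
  norm_num [-map_sub] at hb hm hg hq
  have hm2 : ‖restr (vecSupp hs)ᶜ xstar‖ ≤ 1.2 * ‖restr Jᶜ xstar‖ + 2.2 * ν := by
    refine le_of_sq_le_sq_add_sq (q := ‖restr (J \ vecSupp hs) xstar‖) (κ := 0.48722) hm0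
      (norm_nonneg _) (by positivity) (by norm_num) (by norm_num)
      (by norm_num [-map_sub]; linarith) ?_
    rw [← norm_restr_union_sq]
    · gcongr
      refine norm_restr_mono ?_ _
      intro i
      simp only [Finset.mem_union, Finset.mem_compl, Finset.mem_sdiff]
      tauto
    · rw [Finset.disjoint_left]
      intro i
      simp only [Finset.mem_compl, Finset.mem_sdiff]
      tauto
  have he := H.norm_error_le (by norm_num) subset_rfl hx'
    (card_union_le_add hJ' hstar (by omega)) h0' (a := 1.06) (by norm_num) (by norm_num)
  have hm20 := norm_nonneg (restr (vecSupp hs)ᶜ xstar)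
  norm_num at he hm2
  refine ⟨vecSupp hs, hx', ?_, ?_⟩ <;> norm_num <;> linarith

end Steps

/-! ### Counting the iterations -/

section Counting

/-- Along a geometrically decreasing positive sequence `e`, the values `(a / e t)²` with
`a ≤ e t` add up to at most `1 / (1 - ρ²)`. The bound by `(a / e T)²` makes the induction work. -/
theorem sum_sq_div_le {ρ a : ℝ} (hρ0 : 0 ≤ ρ) (hρ1 : ρ ≤ 1) (ha : 0 ≤ a) (e : ℕ → ℝ) (T : ℕ)
    (hpos : ∀ t ≤ T, 0 < e t) (hdec : ∀ t < T, e (t + 1) ≤ ρ * e t) :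
    (1 - ρ ^ 2) * ∑ t ∈ Finset.range (T + 1), (if a ≤ e t then (a / e t) ^ 2 else 0) ≤ 1 ∧
    (1 - ρ ^ 2) * ∑ t ∈ Finset.range (T + 1), (if a ≤ e t then (a / e t) ^ 2 else 0) ≤
      (a / e T) ^ 2 := by
  have hρ2 : ρ ^ 2 ≤ 1 := pow_le_one₀ hρ0 hρ1
  induction T with
  | zero =>
    have h0 := hpos 0 le_rfl
    rw [Finset.sum_range_one]
    split_ifs with h
    · have h1 : (a / e 0) ^ 2 ≤ 1 := pow_le_one₀ (by positivity) ((div_le_one h0).2 h)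
      constructor <;> nlinarith [sq_nonneg (a / e 0), sq_nonneg ρ]
    · constructor
      · simp
      · rw [mul_zero]; positivity
  | succ T ih =>
    obtain ⟨ih1, ih2⟩ := ih (fun t ht => hpos t (by omega)) (fun t ht => hdec t (by omega))
    have h0 := hpos (T + 1) le_rfl
    have hT := hpos T (by omega)
    rw [Finset.sum_range_succ]
    split_ifs with h
    · have h1 : (a / e (T + 1)) ^ 2 ≤ 1 := pow_le_one₀ (by positivity) ((div_le_one h0).2 h)
      have h2 : (a / e T) ^ 2 ≤ ρ ^ 2 * (a / e (T + 1)) ^ 2 := by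
        rw [← mul_pow]
        refine pow_le_pow_left₀ (by positivity) ?_ 2
        rw [div_le_iff₀ hT, mul_assoc, div_mul_eq_mul_div, mul_div_assoc', le_div_iff₀ h0]
        nlinarith [mul_le_mul_of_nonneg_left (hdec T (by omega)) ha]
      constructor <;> nlinarith
    · rw [add_zero]
      refine ⟨ih1, ih1.trans ?_⟩
      exact one_le_pow₀ ((one_le_div h0).2 (not_le.1 h).le)

variable {𝕜 : Type*} [RCLike 𝕜] {n s : ℕ}

/-- If the errors `e t` decrease geometrically while each of them is at most `D` times the norm of
the signal entries missed at time `t`, then only `O(s)` steps are possible. Indeed the missed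
entries are at most `e t`, so that every step contributes at least `1` to
`D² ∑ₜ ∑ᵢ (|xᵢ| / e t)²`, where only the `i` with `|xᵢ| ≤ e t` are counted; by the geometric decay
each of the `s` entries contributes at most `D² / (1 - ρ²)` in total. -/
theorem iterations_mul_le {ρ D : ℝ} (hρ0 : 0 ≤ ρ) (hρ1 : ρ ≤ 1) {xstar : EuclideanSpace 𝕜 (Fin n)}
    (hstar : IsSparse s xstar) (e : ℕ → ℝ) (J : ℕ → Finset (Fin n)) (T : ℕ)
    (hpos : ∀ t ≤ T, 0 < e t) (hdec : ∀ t < T, e (t + 1) ≤ ρ * e t)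
    (hmiss : ∀ t ≤ T, e t ≤ D * ‖restr (J t)ᶜ xstar‖)
    (hle : ∀ t ≤ T, ∀ i ∉ J t, ‖xstar i‖ ≤ e t) :
    (1 - ρ ^ 2) * (T + 1) ≤ D ^ 2 * s := by
  have hρ2 : ρ ^ 2 ≤ 1 := pow_le_one₀ hρ0 hρ1
  set g : ℕ → Fin n → ℝ := fun t i => if ‖xstar i‖ ≤ e t then (‖xstar i‖ / e t) ^ 2 else 0 with hg
  have hg0 : ∀ t i, 0 ≤ g t i := fun t i => by
    simp only [hg]
    split_ifs <;> positivity
  have hstep : ∀ t ∈ Finset.range (T + 1), 1 ≤ D ^ 2 * ∑ i ∈ vecSupp xstar, g t i := by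
    intro t ht
    have ht : t ≤ T := by simpa [Nat.lt_succ_iff] using ht
    have he := hpos t ht
    have h1 := pow_le_pow_left₀ he.le (hmiss t ht) 2
    rw [mul_pow, ← restr_sdiff_vecSupp, norm_restr_sq] at h1
    have h2 : ∑ i ∈ vecSupp xstar \ J t, ‖xstar i‖ ^ 2 ≤
        e t ^ 2 * ∑ i ∈ vecSupp xstar, g t i := by
      rw [Finset.mul_sum]
      refine le_trans (Finset.sum_le_sum fun i hi => ?_) (Finset.sum_le_sum_of_subset_of_nonneg
        Finset.sdiff_subset fun i _ _ => mul_nonneg (sq_nonneg _) (hg0 t i))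
      simp only [hg, if_pos (hle t ht i (Finset.mem_sdiff.1 hi).2)]
      rw [← mul_pow, mul_div_cancel₀ _ he.ne']
    have h3 := h1.trans (mul_le_mul_of_nonneg_left h2 (sq_nonneg D))
    have h4 : 0 < e t ^ 2 := by positivity
    by_contra! hlt
    nlinarith [mul_lt_mul_of_pos_left hlt h4]
  have hsum : ((T : ℝ) + 1) ≤ D ^ 2 * ∑ i ∈ vecSupp xstar, ∑ t ∈ Finset.range (T + 1), g t i := by
    rw [Finset.sum_comm, Finset.mul_sum]
    calc ((T : ℝ) + 1) = ∑ t ∈ Finset.range (T + 1), (1 : ℝ) := by simp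
      _ ≤ _ := Finset.sum_le_sum hstep
  have hcol : (1 - ρ ^ 2) * ∑ i ∈ vecSupp xstar, ∑ t ∈ Finset.range (T + 1), g t i ≤ s := by
    rw [Finset.mul_sum]
    calc _ ≤ ∑ i ∈ vecSupp xstar, (1 : ℝ) := Finset.sum_le_sum fun i _ =>
          (sum_sq_div_le hρ0 hρ1 (norm_nonneg (xstar i)) e T hpos hdec).1
      _ ≤ s := by
          rw [Finset.sum_const, nsmul_one]
          exact_mod_cast hstar
  calc (1 - ρ ^ 2) * ((T : ℝ) + 1)
      ≤ (1 - ρ ^ 2) * (D ^ 2 * ∑ i ∈ vecSupp xstar, ∑ t ∈ Finset.range (T + 1), g t i) :=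
        mul_le_mul_of_nonneg_left hsum (by linarith)
    _ = D ^ 2 * ((1 - ρ ^ 2) * ∑ i ∈ vecSupp xstar, ∑ t ∈ Finset.range (T + 1), g t i) := by ring
    _ ≤ _ := mul_le_mul_of_nonneg_left hcol (sq_nonneg D)

/-- A sequence obeying the error bounds reaches noise level within `O(s)` steps and stays there.
While the error exceeds the noise level, the noise terms are absorbed by weakening the contraction
factor to `0.9999` and the constant `3` to `6`. -/
theorem norm_sub_le_of_errorBounds {ν : ℝ} (hν : 0 ≤ ν) {xstar : EuclideanSpace 𝕜 (Fin n)}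
    (hstar : IsSparse s xstar) {x : ℕ → EuclideanSpace 𝕜 (Fin n)}
    (hx : ∀ t, ErrorBounds ν xstar (x t) (x (t + 1))) {t : ℕ} (ht : 190000 * (s + 1) ≤ t) :
    ‖x (t + 1) - xstar‖ ≤ 250000 * ν := by
  choose J hJ hmiss hcon using hx
  by_contra! hlt
  rw [norm_sub_rev] at hlt
  have hbig : ∀ k ≤ t, 250000 * ν < ‖xstar - x (k + 1)‖ := fun k hk => by
    induction hk using Nat.decreasingInduction with
    | self => exact hlt
    | of_succ k hk ih =>
      by_contra! hle
      have := hcon (k + 1)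
      norm_num at this
      linarith
  have key := iterations_mul_le (ρ := 0.9999) (D := 6) (by norm_num) (by norm_num) hstar
    (fun k => ‖xstar - x (k + 1)‖) J t
    (fun k hk => lt_of_le_of_lt (by positivity) (hbig k hk))
    (fun k hk => by
      have h1 := hcon (k + 1)
      have h2 := hbig k hk.le
      norm_num at h1 ⊢
      linarith)
    (fun k hk => by linarith [hmiss k, hbig k hk])
    (fun k _ i hi => by
      have h0 : x (k + 1) i = 0 := vecSupp_subset_iff.1 (hJ k) i hi
      simpa [h0] using norm_apply_le (xstar - x (k + 1)) i)
  have ht' : (190000 : ℝ) * (s + 1) ≤ t := by exact_mod_cast ht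
  norm_num at key
  have : (0 : ℝ) ≤ s := s.cast_nonneg
  linarith

end Counting

/-! ### Convergence of the oblique pursuits -/

section Main

variable {𝕜 : Type*} [RCLike 𝕜] {m n s : ℕ} {Ψ Ψt : Matrix (Fin m) (Fin n) 𝕜}
  {xstar : EuclideanSpace 𝕜 (Fin n)} {z : EuclideanSpace 𝕜 (Fin m)}

theorem ObliqueAlg.Step.isSparse {alg : ObliqueAlg} {y : EuclideanSpace 𝕜 (Fin m)}
    {x x' : EuclideanSpace 𝕜 (Fin n)} (h : alg.Step s Ψ Ψt y x x') : IsSparse s x' := by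
  cases alg with
  | obSP =>
    obtain ⟨_, _, hs, _, _, hhs, hx'⟩ := h
    exact isSparse_of_vecSupp_subset hx'.1 hhs.1
  | obCoSaMP =>
    obtain ⟨_, _, _, _, hx'⟩ := h
    exact hx'.1
  | obHTP =>
    obtain ⟨_, hh, hx'⟩ := h
    exact isSparse_of_vecSupp_subset hx'.1 hh.1

theorem ObliqueAlg.Generates.isSparse {alg : ObliqueAlg} {y : EuclideanSpace 𝕜 (Fin m)}
    {x : ℕ → EuclideanSpace 𝕜 (Fin n)} (h : alg.Generates s Ψ Ψt y x) : ∀ t, IsSparse s (x t)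
  | 0 => h.1
  | t + 1 => (h.2 t).isSparse

/-- The first iteration is left out: oblique subspace pursuit needs the current iterate to be a
least squares solution, which an arbitrary starting vector is not. -/
theorem ObliqueAlg.Generates.errorBounds {alg : ObliqueAlg} {x : ℕ → EuclideanSpace 𝕜 (Fin n)}
    (h : alg.Generates s Ψ Ψt (Matrix.toEuclideanLin Ψ xstar + z) x) (hstar : IsSparse s xstar)
    (hθ : rboc (alg.order * s) (Ψt.conjTranspose * Ψ) < alg.threshold) (t : ℕ) :
    ErrorBounds (√(2 + ric (alg.order * s) Ψt) * ‖z‖) xstar (x (t + 1)) (x (t + 2)) := by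
  have H := nearIdentity_of_rboc_lt hθ z
  have hx := h.isSparse (t + 1)
  have hstep := h.2 (t + 1)
  cases alg with
  | obSP =>
    simp only [ObliqueAlg.order, ObliqueAlg.threshold] at H ⊢
    obtain ⟨g, xt, hs, hg, hxt, hhs, hx'⟩ := hstep
    obtain ⟨_, _, hs', _, _, hhs', hprev⟩ := h.2 t
    rw [proxy_eq] at hg
    have hgc : (vecSupp g).card ≤ s := hg.1
    have hhsc : (vecSupp hs).card ≤ s := hhs.1
    have hhsc' : (vecSupp hs').card ≤ s := hhs'.1
    refine errorBounds_of_obSP H hstar hx ?_ hg hxt.1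
      (hxt.restr_eq_zero H (by norm_num) (card_union_le_add hx hgc (by omega))) hhs hx'.1
      (hx'.restr_eq_zero H (by norm_num) (by omega))
    have h0 := hprev.restr_eq_zero H (by norm_num) (by omega)
    refine norm_le_zero_iff.1 ((norm_restr_mono hprev.1 _).trans ?_)
    rw [h0, norm_zero]
  | obCoSaMP =>
    simp only [ObliqueAlg.order, ObliqueAlg.threshold] at H ⊢
    obtain ⟨g, xt, hg, hxt, hx'⟩ := hstep
    rw [proxy_eq] at hg
    have hgc : (vecSupp g).card ≤ 2 * s := hg.1
    exact errorBounds_of_obCoSaMP H hstar hx hg hxt.1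
      (hxt.restr_eq_zero H (by norm_num) (card_union_le_add hx hgc (by omega))) hx'
  | obHTP =>
    simp only [ObliqueAlg.order, ObliqueAlg.threshold] at H ⊢
    obtain ⟨g, hg, hx'⟩ := hstep
    rw [proxy_eq] at hg
    have hgc : (vecSupp g).card ≤ s := hg.1
    exact errorBounds_of_obHTP H hstar hx hg hx'.1
      (hx'.restr_eq_zero H (by norm_num) (by omega))

end Main

theorem mainTheorem5 (alg : ObliqueAlg) :
    ∃ C₁ : ℕ, 0 < C₁ ∧ ∃ C₂ : ℝ → ℝ → ℝ, (∀ a b : ℝ, 0 < C₂ a b) ∧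
      ∀ (𝕜 : Type*) [RCLike 𝕜] (m n s : ℕ) (Ψ Ψt : Matrix (Fin m) (Fin n) 𝕜)
        (xstar : EuclideanSpace 𝕜 (Fin n)) (z : EuclideanSpace 𝕜 (Fin m))
        (x : ℕ → EuclideanSpace 𝕜 (Fin n)),
        IsSparse s xstar →
        rboc (alg.order * s) (Ψt.conjTranspose * Ψ) < alg.threshold →
        alg.Generates s Ψ Ψt (Matrix.toEuclideanLin Ψ xstar + z) x →
        ∀ t : ℕ, C₁ * (s + 1) ≤ t →
          ‖x t - xstar‖ ≤ C₂ (ric (alg.order * s) Ψ) (ric (alg.order * s) Ψt) * ‖z‖ := by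
  -- the absolute value only serves to make the constant positive for all real arguments
  refine ⟨200000, by norm_num, fun _ b => 250000 * √(2 + |b|), fun _ b => by positivity, ?_⟩
  intro 𝕜 _ m n s Ψ Ψt xstar z x hstar hθ hgen t ht
  obtain ⟨k, rfl⟩ : ∃ k, t = k + 2 := ⟨t - 2, by omega⟩
  have hric : 0 ≤ ric (alg.order * s) Ψt := Real.sInf_nonneg fun δ hδ => hδ.1
  have := norm_sub_le_of_errorBounds (x := fun j => x (j + 1)) (by positivity) hstar
    (fun j => hgen.errorBounds hstar hθ j) (t := k) (by omega)
  simpa [abs_of_nonneg hric, mul_assoc] using this
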